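/- Theorem (Omniscience principles). Let $\mathsf{LPO}:\mathbb N^{\mathbb N}\to\mathbb N$ be given by $\mathsf{LPO}(p)=0$ if $p(n)=0$ for some $n$, and $\mathsf{LPO}(p)=1$ otherwise. Let $\mathsf{LLPO}:\subseteq\mathbb N^{\mathbb N}\rightrightarrows\mathbb N$ be the multi-valued function with domain $\{p : p(k)\neq 0 \text{ for at most one } k\}$ such that, for $p$ in the domain, $\mathsf{LLPO}(p)\subseteq\{0,1\}$, with $0\in\mathsf{LLPO}(p)$ iff $p(2n)=0$ for all $n$, and $1\in\mathsf{LLPO}(p)$ iff $p(2n+1)=0$ for all $n$. Here $\mathbb N^{\mathbb N}$ is represented by the identity and $\mathbb N$ by $p\mapsto p(0)$. The parallelization of $f:\subseteq X\rightrightarrows Y$ is $\widehat f:\subseteq X^{\mathbb N}\rightrightarrows Y^{\mathbb N}$, $\widehat f((x_i)_i)=\prod_i f(x_i)$, where the sequence space of a space represented by $\delta$ is represented by $\delta^{\mathbb N}\langle p_0,p_1,\dots\rangle=(\delta(p_i))_i$, with a standard computable tupling $\langle p_0,p_1,\dots\rangle$. A partial $F:\subseteq\mathbb N^{\mathbb N}\to\mathbb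 N^{\mathbb N}$ realizes $f:\subseteq X\rightrightarrows Y$ if $\delta_Y F(p)\in f(\delta_X(p))$ for all $p$ with $\delta_X(p)\in\mathrm{dom}(f)$. We write $f\le_W g$ if there are computable partial functions $H,K:\subseteq\mathbb N^{\mathbb N}\to\mathbb N^{\mathbb N}$ such that $p\mapsto H\langle p,GK(p)\rangle$ realizes $f$ for every realizer $G$ of $g$; $f<_W g$ if $f\le_W g$ and $g\not\le_W f$; and $f\mid_W g$ if $f\not\le_W g$ and $g\not\le_W f$. For $a\in\mathbb N^{\mathbb N}$, $\le_W^a$ denotes the same relation with $H,K$ only required to be computable relative to the oracle $a$. Then \[\mathsf{LLPO}<_W\mathsf{LPO},\qquad \mathsf{LPO}\mid_W\widehat{\mathsf{LLPO}},\qquad \widehat{\mathsf{LLPO}}<_W\widehat{\mathsf{LPO}}.\] Moreover, all the negative statements hold relative to an arbitrary oracle: for every $a\in\mathbb N^{\mathbb N}$, \[\mathsf{LPO}\not\le_W^a\mathsf{LLPO},\quad \mathsf{LPO}\not\le_W^a\widehat{\mathsf{LLPO}},\quad \widehat{\mathsf{LLPO}}\not\le_W^a\mathsf{LPO},\quad \widehat{\mathsf{LPO}}\not\le_W^a\widehat{\mathsf{LLPO}}.\]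 -/

import Mathlib

namespace WeihrauchDegrees

/-- Baire space `ℕ^ℕ`. -/
abbrev Baire : Type := ℕ → ℕ

/-! ### Type-two computability -/

/-- Partial recursive functionals relative to a set `A` of oracles. `PartrecFunctional A Φ` says
that `Φ p n` is computed by one algorithm, uniformly in `p` and `n`, which may query the sequence
`p` and the elements of `A`. The clauses are those of `Nat.RecursiveIn`, with the sequence `p`
as an additional argument (`input` is the query to `p`). -/
inductive PartrecFunctional (A : Set Baire) : (Baire → ℕ →. ℕ) → Prop
  | zero : PartrecFunctional A fun _ _ => Part.some 0
  | succ : PartrecFunctional A fun _ n => Part.some (n + 1)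
  | left : PartrecFunctional A fun _ n => Part.some n.unpair.1
  | right : PartrecFunctional A fun _ n => Part.some n.unpair.2
  | input : PartrecFunctional A fun p n => Part.some (p n)
  | oracle (a : Baire) (ha : a ∈ A) : PartrecFunctional A fun _ n => Part.some (a n)
  | pair {Φ Ψ : Baire → ℕ →. ℕ} (hΦ : PartrecFunctional A Φ) (hΨ : PartrecFunctional A Ψ) :
      PartrecFunctional A fun p n => Nat.pair <$> Φ p n <*> Ψ p n
  | comp {Φ Ψ : Baire → ℕ →. ℕ} (hΦ : PartrecFunctional A Φ) (hΨ : PartrecFunctional A Ψ) :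
      PartrecFunctional A fun p n => Ψ p n >>= Φ p
  | prec {Φ Ψ : Baire → ℕ →. ℕ} (hΦ : PartrecFunctional A Φ) (hΨ : PartrecFunctional A Ψ) :
      PartrecFunctional A fun p m =>
        m.unpair.2.rec (Φ p m.unpair.1) fun y IH => do
          let i ← IH
          Ψ p (Nat.pair m.unpair.1 (Nat.pair y i))
  | rfind {Φ : Baire → ℕ →. ℕ} (hΦ : PartrecFunctional A Φ) :
      PartrecFunctional A fun p m =>
        Nat.rfind fun n => (fun k => decide (k = 0)) <$> Φ p (Nat.pair m n)

/-- A partial function `F :⊆ ℕ^ℕ → ℕ^ℕ` is computable relative to `A` if a single partial recursive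
functional (with oracles from `A`) produces all the values of `F(p)` from `p`, for every
`p ∈ dom F`. -/
def ComputableRel (A : Set Baire) (F : Baire →. Baire) : Prop :=
  ∃ Φ : Baire → ℕ →. ℕ, PartrecFunctional A Φ ∧
    ∀ p q : Baire, q ∈ F p → ∀ n : ℕ, q n ∈ Φ p n

/-! ### Tupling functions -/

/-- The pairing `⟨p, q⟩ = p(0) q(0) p(1) q(1) …`. -/
def pairSeq (p q : Baire) : Baire := fun n => if n % 2 = 0 then p (n / 2) else q (n / 2)

/-- The countable tupling `⟨p₀, p₁, p₂, …⟩`, given by `⟨p₀, p₁, …⟩⟨i, k⟩ = pᵢ(k)`. -/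
def tupleSeq (p : ℕ → Baire) : Baire := fun n => p n.unpair.1 n.unpair.2

/-- The projections of the countable tupling. -/
def projSeq (i : ℕ) (p : Baire) : Baire := fun k => p (Nat.pair i k)

theorem projSeq_tupleSeq (i : ℕ) (p : ℕ → Baire) : projSeq i (tupleSeq p) = p i := by
  funext k; simp [projSeq, tupleSeq]

/-! ### Represented spaces, multi-valued functions, realizers -/

/-- A represented space: a set with a surjective partial map from Baire space onto it. -/
structure RepSpace where
  carrier : Type
  rep : Baire →. carrier
  surj : ∀ x : carrier, ∃ p : Baire, x ∈ rep p

/-- Baire space, represented by the identity. -/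
def RepSpace.baire : RepSpace where
  carrier := Baire
  rep := fun p => Part.some p
  surj := fun x => ⟨x, Part.mem_some x⟩

/-- The natural numbers, represented by `δ_ℕ(p) = p(0)`. -/
def RepSpace.nat : RepSpace where
  carrier := ℕ
  rep := fun p => Part.some (p 0)
  surj := fun n => ⟨fun _ => n, Part.mem_some n⟩

/-- The sequence space `X^ℕ`, represented by `δ^ℕ⟨p₀, p₁, …⟩ = (δ(pᵢ))ᵢ`. -/
def RepSpace.seq (X : RepSpace) : RepSpace where
  carrier := ℕ → X.carrier
  rep := fun p => ⟨∀ i, (X.rep (projSeq i p)).Dom, fun h i => (X.rep (projSeq i p)).get (h i)⟩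
  surj := fun x => by
    choose p hp using fun i => X.surj (x i)
    have h : ∀ i, x i ∈ X.rep (projSeq i (tupleSeq p)) := fun i => by
      rw [projSeq_tupleSeq]; exact hp i
    exact ⟨tupleSeq p, fun i => (h i).1, funext fun i => (h i).2⟩

/-- A multi-valued function `f :⊆ X ⇉ Y`, with `dom f = {x | f x ≠ ∅}`. -/
def MultiFun (X Y : RepSpace) : Type := X.carrier → Set Y.carrier

/-- `F ⊢ f`: for every `p` with `δ_X(p) ∈ dom f`, `δ_Y F(p)` is defined and lies in `f(δ_X(p))`. -/
def Realizes {X Y : RepSpace} (F : Baire →. Baire) (f : MultiFun X Y) : Prop :=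
  ∀ p : Baire, ∀ x ∈ X.rep p, (f x).Nonempty → ∃ q ∈ F p, ∃ y ∈ Y.rep q, y ∈ f x

/-- The parallelization of `f`: `(xᵢ)ᵢ ↦ ∏ᵢ f(xᵢ)`. -/
def parallelization {X Y : RepSpace} (f : MultiFun X Y) : MultiFun X.seq Y.seq :=
  fun (x : ℕ → X.carrier) => {y : ℕ → Y.carrier | ∀ i, y i ∈ f (x i)}

/-! ### Weihrauch reducibility -/

/-- The partial function `H⟨id, GK⟩`. -/
def sandwich (H K G : Baire →. Baire) : Baire →. Baire :=
  fun p => (K p).bind fun k => (G k).bind fun q => H (pairSeq p q)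

/-- Weihrauch reducibility, relative to `A`, of sets of partial functions on Baire space. -/
def SetReducible (A : Set Baire) (𝓕 𝓖 : Set (Baire →. Baire)) : Prop :=
  ∃ H K : Baire →. Baire, ComputableRel A H ∧ ComputableRel A K ∧
    ∀ G ∈ 𝓖, ∃ F ∈ 𝓕, F = sandwich H K G

/-- Weihrauch reducibility, relative to `A`, of multi-valued functions on represented spaces. -/
def WeihrauchReducibleRel (A : Set Baire) {X Y U V : RepSpace}
    (f : MultiFun X Y) (g : MultiFun U V) : Prop :=
  SetReducible A {F | Realizes F f} {G | Realizes G g}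

/-- Weihrauch reducibility `f ≤_W g` (no oracle). -/
def WeihrauchReducible {X Y U V : RepSpace} (f : MultiFun X Y) (g : MultiFun U V) : Prop :=
  WeihrauchReducibleRel ∅ f g

/-- `f <_W g`. -/
def WeihrauchLT {X Y U V : RepSpace} (f : MultiFun X Y) (g : MultiFun U V) : Prop :=
  WeihrauchReducible f g ∧ ¬ WeihrauchReducible g f

/-- `f |_W g`. -/
def WeihrauchIncomparable {X Y U V : RepSpace} (f : MultiFun X Y) (g : MultiFun U V) : Prop :=
  ¬ WeihrauchReducible f g ∧ ¬ WeihrauchReducible g f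

/-! ### Omniscience principles -/

open Classical in
/-- The limited principle of omniscience, a (total, single-valued) function `ℕ^ℕ → ℕ`. -/
noncomputable def LPO : MultiFun RepSpace.baire RepSpace.nat :=
  fun (p : Baire) => ({if ∃ n, p n = 0 then 0 else 1} : Set ℕ)

/-- The lesser limited principle of omniscience, defined on the sequences that are non-zero in at
most one place. -/
def LLPO : MultiFun RepSpace.baire RepSpace.nat :=
  fun (p : Baire) => {i : ℕ | (∀ k l, p k ≠ 0 → p l ≠ 0 → k = l) ∧
    ((i = 0 ∧ ∀ n, p (2 * n) = 0) ∨ (i = 1 ∧ ∀ n, p (2 * n + 1) = 0))}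

end WeihrauchDegrees

/-! The positive reductions ask `LPO` whether some even place is non-zero, componentwise for the
parallelizations. The negative statements are topological: a functional computable relative to any
oracle is continuous on its domain (`ComputableRel.tendsto`), so oracles do not help. Answers to
`LLPO` lie in `{0, 1}` and its graph conditions are closed, so solutions along a convergent sequence
have ultrafilter limits that solve the limit instance. This property passes to parallelizations,
whereas `LPO` jumps at the constant sequence 1, which rules out reductions of `LPO`
(`SeqDiscontinuous.not_reducible`). For the parallelization of `LLPO` against `LPO`: one fixed
answer of `LPO` cannot serve all small perturbations of a vanishing component
(`not_tendsto_solutions`). The answer 0 is stable under perturbation, so it never occurs while a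
component vanishes. Perturbing one of two vanishing components then fixes the answer at 1. -/

open Filter Topology

namespace WeihrauchDegrees

/-! ### Realizers and reducibility in terms of names -/

/-- `q` is a name of a value of `f` at the point named by `p`. -/
def Solves {X Y : RepSpace} (f : MultiFun X Y) (p q : Baire) : Prop :=
  ∃ x ∈ X.rep p, ∃ y ∈ Y.rep q, y ∈ f x

theorem realizes_iff {X Y : RepSpace} {F : Baire →. Baire} {f : MultiFun X Y} :
    Realizes F f ↔ ∀ p, (∃ r, Solves f p r) → ∃ r ∈ F p, Solves f p r := by
  constructor
  · rintro h p ⟨r, x, hx, y, -, hy⟩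
    obtain ⟨q, hq, z, hz, hzx⟩ := h p x hx ⟨y, hy⟩
    exact ⟨q, hq, x, hx, z, hz, hzx⟩
  · rintro h p x hx ⟨y, hy⟩
    obtain ⟨r, hr⟩ := Y.surj y
    obtain ⟨q, hq, x', hx', z, hz, hzx⟩ := h p ⟨r, x, hx, y, hr, hy⟩
    obtain rfl := Part.mem_unique hx hx'
    exact ⟨q, hq, z, hz, hzx⟩

theorem mem_sandwich {H K G : Baire →. Baire} {p r : Baire} :
    r ∈ sandwich H K G p ↔ ∃ k ∈ K p, ∃ q ∈ G k, r ∈ H (pairSeq p q) := by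
  simp [sandwich, Part.mem_bind_iff]

/-- A realizer of `f` that is undefined outside the domain of `f`. -/
noncomputable def chosenRealizer {X Y : RepSpace} (f : MultiFun X Y) : Baire →. Baire :=
  fun p => ⟨∃ q, Solves f p q, fun h => h.choose⟩

theorem solves_of_mem_chosenRealizer {X Y : RepSpace} {f : MultiFun X Y} {p q : Baire}
    (h : q ∈ chosenRealizer f p) : Solves f p q := by
  obtain ⟨hd, rfl⟩ := h
  exact hd.choose_spec

theorem realizes_chosenRealizer {X Y : RepSpace} (f : MultiFun X Y) :
    Realizes (chosenRealizer f) f :=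
  realizes_iff.2 fun _ h => ⟨h.choose, ⟨h, rfl⟩, h.choose_spec⟩

/-- Any solution of `f` at one name is taken by some realizer of `f`. -/
theorem exists_realizes_eq {X Y : RepSpace} {f : MultiFun X Y} {k q : Baire}
    (h : Solves f k q) : ∃ G, Realizes G f ∧ G k = Part.some q := by
  classical
  refine ⟨fun p => if p = k then Part.some q else chosenRealizer f p,
    realizes_iff.2 fun p hp => ?_, if_pos rfl⟩
  by_cases hpk : p = k
  · exact ⟨q, by simp [hpk], hpk ▸ h⟩
  · simpa only [if_neg hpk] using realizes_iff.1 (realizes_chosenRealizer f) p hp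

/-- This removes realizers: `chosenRealizer` forces `K p` to name a point of the domain of `g`, and
`exists_realizes_eq` makes `H` cope with every solution there. -/
theorem weihrauchReducibleRel_iff {A : Set Baire} {X Y U V : RepSpace}
    {f : MultiFun X Y} {g : MultiFun U V} :
    WeihrauchReducibleRel A f g ↔ ∃ H K : Baire →. Baire, ComputableRel A H ∧ ComputableRel A K ∧
      ∀ p, (∃ r, Solves f p r) → ∃ k ∈ K p, (∃ q, Solves g k q) ∧
        ∀ q, Solves g k q → ∃ r ∈ H (pairSeq p q), Solves f p r := by
  constructor
  · rintro ⟨H, K, hH, hK, h⟩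
    have h' : ∀ G, Realizes G g → Realizes (sandwich H K G) f := by
      intro G hG
      obtain ⟨F, hF, rfl⟩ := h G hG
      exact hF
    refine ⟨H, K, hH, hK, fun p hp => ?_⟩
    obtain ⟨r, hr, -⟩ := realizes_iff.1 (h' _ (realizes_chosenRealizer g)) p hp
    obtain ⟨k, hk, q, hq, -⟩ := mem_sandwich.1 hr
    refine ⟨k, hk, ⟨q, solves_of_mem_chosenRealizer hq⟩, fun q' hq' => ?_⟩
    obtain ⟨G, hG, hGk⟩ := exists_realizes_eq hq'
    obtain ⟨r', hr', hs⟩ := realizes_iff.1 (h' G hG) p hp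
    obtain ⟨k', hk', q'', hq'', hr''⟩ := mem_sandwich.1 hr'
    obtain rfl := Part.mem_unique hk hk'
    rw [hGk, Part.mem_some_iff] at hq''
    subst hq''
    exact ⟨r', hr'', hs⟩
  · rintro ⟨H, K, hH, hK, h⟩
    refine ⟨H, K, hH, hK, fun G hG => ⟨_, realizes_iff.2 fun p hp => ?_, rfl⟩⟩
    obtain ⟨k, hk, hkd, hs⟩ := h p hp
    obtain ⟨q, hq, hkq⟩ := realizes_iff.1 hG k hkd
    obtain ⟨r, hr, hpr⟩ := hs q hkq
    exact ⟨r, mem_sandwich.2 ⟨k, hk, q, hq, hr⟩, hpr⟩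

theorem solves_parallelization {X Y : RepSpace} {f : MultiFun X Y} {p q : Baire} :
    Solves (parallelization f) p q ↔ ∀ i, Solves f (projSeq i p) (projSeq i q) := by
  constructor
  · rintro ⟨x, ⟨hx, rfl⟩, y, ⟨hy, rfl⟩, h⟩ i
    exact ⟨_, Part.get_mem (hx i), _, Part.get_mem (hy i), h i⟩
  · intro h
    choose x hx y hy hxy using h
    exact ⟨x, ⟨fun i => (hx i).1, funext fun i => (hx i).2⟩,
      y, ⟨fun i => (hy i).1, funext fun i => (hy i).2⟩, hxy⟩

theorem solves_LPO {p q : Baire} :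
    Solves LPO p q ↔ (q 0 = 0 ∧ ∃ n, p n = 0) ∨ (q 0 = 1 ∧ ∀ n, p n ≠ 0) := by
  have : Solves LPO p q ↔ q 0 ∈ LPO p := by
    constructor
    · rintro ⟨x, hx, y, hy, h⟩
      obtain rfl := Part.mem_some_iff.1 hx
      obtain rfl := Part.mem_some_iff.1 hy
      exact h
    · exact fun h => ⟨p, Part.mem_some p, q 0, Part.mem_some (q 0), h⟩
  rw [this]
  by_cases h : ∃ n, p n = 0
  · have h' : ¬ ∀ n, p n ≠ 0 := by simpa using h
    have : LPO p = ({0} : Set ℕ) := congrArg (fun i : ℕ => ({i} : Set ℕ)) (if_pos h)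
    rw [this]
    change q 0 = 0 ↔ _
    tauto
  · have h' : ∀ n, p n ≠ 0 := by simpa using h
    have : LPO p = ({1} : Set ℕ) := congrArg (fun i : ℕ => ({i} : Set ℕ)) (if_neg h)
    rw [this]
    change q 0 = 1 ↔ _
    tauto

theorem solves_LLPO {p q : Baire} :
    Solves LLPO p q ↔ (∀ k l, p k ≠ 0 → p l ≠ 0 → k = l) ∧
      ((q 0 = 0 ∧ ∀ n, p (2 * n) = 0) ∨ (q 0 = 1 ∧ ∀ n, p (2 * n + 1) = 0)) := by
  constructor
  · rintro ⟨x, hx, y, hy, h⟩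
    obtain rfl := Part.mem_some_iff.1 hx
    obtain rfl := Part.mem_some_iff.1 hy
    exact h
  · exact fun h => ⟨p, Part.mem_some p, q 0, Part.mem_some (q 0), h⟩

theorem exists_solves_LPO (p : Baire) : ∃ q, Solves LPO p q := by
  by_cases h : ∃ n, p n = 0
  · exact ⟨fun _ => 0, solves_LPO.2 (.inl ⟨rfl, h⟩)⟩
  · exact ⟨fun _ => 1, solves_LPO.2 (.inr ⟨rfl, by simpa using h⟩)⟩

theorem exists_solves_LLPO {p : Baire} (hp : ∀ k l, p k ≠ 0 → p l ≠ 0 → k = l) :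
    ∃ q, Solves LLPO p q := by
  by_cases h : ∀ n, p (2 * n) = 0
  · exact ⟨fun _ => 0, solves_LLPO.2 ⟨hp, .inl ⟨rfl, h⟩⟩⟩
  · obtain ⟨m, hm⟩ := not_forall.1 h
    refine ⟨fun _ => 1, solves_LLPO.2 ⟨hp, .inr ⟨rfl, fun n => ?_⟩⟩⟩
    by_contra hn
    have := hp _ _ hm hn
    omega

theorem exists_solves_parallelization {X Y : RepSpace} {f : MultiFun X Y} {p : Baire}
    (h : ∀ i, ∃ q, Solves f (projSeq i p) q) : ∃ q, Solves (parallelization f) p q := by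
  choose q hq using h
  exact ⟨tupleSeq q, solves_parallelization.2 fun i => by rw [projSeq_tupleSeq]; exact hq i⟩

/-! ### Computable functions -/

theorem PartrecFunctional.of_partrec (A : Set Baire) {f : ℕ →. ℕ} (h : Nat.Partrec f) :
    PartrecFunctional A fun _ => f := by
  induction h with
  | zero => exact .zero
  | succ => exact .succ
  | left => exact .left
  | right => exact .right
  | pair _ _ h₁ h₂ => exact .pair h₁ h₂
  | comp _ _ h₁ h₂ => exact .comp h₁ h₂
  | prec _ _ h₁ h₂ => exact .prec h₁ h₂
  | rfind _ h => exact .rfind h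

theorem PartrecFunctional.of_computable (A : Set Baire) {f : ℕ → ℕ} (h : Computable f) :
    PartrecFunctional A fun _ n => Part.some (f n) :=
  .of_partrec A (Partrec.nat_iff.1 h)

/-- Querying the input at computable places and processing the answers computably is computable. -/
theorem computableRel_query (A : Set Baire) {c κ : ℕ → ℕ} (hc : Computable c)
    (hκ : Computable κ) : ComputableRel A fun p => Part.some fun n => c (p (κ n)) := by
  refine ⟨_, .comp (.of_computable A hc) (.comp .input (.of_computable A hκ)), ?_⟩
  intro p q hq n
  obtain rfl := Part.mem_some_iff.1 hq
  simp

theorem computable_one_sub : Computable fun n : ℕ => 1 - n :=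
  (Primrec.nat_sub.comp (Primrec.const 1) Primrec.id).to_comp

/-! ### The positive reductions -/

/-- `LLPO` is answered by asking `LPO` whether some even place is non-zero. -/
theorem solves_LLPO_of_solves_LPO {p k q r : Baire} (hp : ∃ r, Solves LLPO p r)
    (hk : ∀ n, k n = 1 - p (2 * n)) (hq : Solves LPO k q) (hr : r 0 = 1 - q 0) :
    Solves LLPO p r := by
  obtain ⟨r', hr'⟩ := hp
  have hdom := (solves_LLPO.1 hr').1
  refine solves_LLPO.2 ⟨hdom, ?_⟩
  rcases solves_LPO.1 hq with ⟨h0, n, hn⟩ | ⟨h1, h⟩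
  · refine .inr ⟨by omega, fun m => ?_⟩
    by_contra hm
    -- `p (2 * n)` is non-zero, and it is the only non-zero value.
    have hn' := hk n
    have := hdom (2 * n) (2 * m + 1) (by omega) hm
    omega
  · refine .inl ⟨by omega, fun n => ?_⟩
    have := hk n
    have := h n
    omega

theorem LLPO_le_LPO : WeihrauchReducible LLPO LPO := by
  refine weihrauchReducibleRel_iff.2 ⟨_, _,
    -- Place 1 of `pairSeq p q` holds `q 0`.
    computableRel_query ∅ computable_one_sub (Computable.const 1),
    computableRel_query ∅ computable_one_sub (κ := fun n => 2 * n)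
      (Primrec.nat_mul.comp (Primrec.const 2) Primrec.id).to_comp, fun p hp => ?_⟩
  exact ⟨_, Part.mem_some _, exists_solves_LPO _, fun q hq => ⟨_, Part.mem_some _,
    solves_LLPO_of_solves_LPO hp (fun _ => rfl) hq rfl⟩⟩

theorem parallelization_LLPO_le_parallelization_LPO :
    WeihrauchReducible (parallelization LLPO) (parallelization LPO) := by
  have hfst : Primrec fun n : ℕ => n.unpair.1 := Primrec.fst.comp Primrec.unpair
  have hsnd : Primrec fun n : ℕ => n.unpair.2 := Primrec.snd.comp Primrec.unpair
  have hH : Primrec fun n : ℕ => 2 * Nat.pair n.unpair.1 0 + 1 :=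
    Primrec.succ.comp (Primrec.nat_mul.comp (Primrec.const 2)
      (Primrec₂.natPair.comp hfst (Primrec.const 0)))
  have hK : Primrec fun n : ℕ => Nat.pair n.unpair.1 (2 * n.unpair.2) :=
    Primrec₂.natPair.comp hfst (Primrec.nat_mul.comp (Primrec.const 2) hsnd)
  refine weihrauchReducibleRel_iff.2 ⟨_, _,
    computableRel_query ∅ computable_one_sub hH.to_comp,
    computableRel_query ∅ computable_one_sub hK.to_comp, fun p hp => ?_⟩
  refine ⟨_, Part.mem_some _, exists_solves_parallelization fun _ => exists_solves_LPO _,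
    fun q hq => ⟨_, Part.mem_some _, solves_parallelization.2 fun i => ?_⟩⟩
  obtain ⟨r, hr⟩ := hp
  refine solves_LLPO_of_solves_LPO ⟨_, solves_parallelization.1 hr i⟩ (fun n => ?_)
    (solves_parallelization.1 hq i) ?_
  · simp [projSeq]
  · have : (2 * Nat.pair i 0 + 1) / 2 = Nat.pair i 0 := by omega
    simp [projSeq, pairSeq, this]

/-! ### Continuity -/

/-- A halting computation queries the input at finitely many places only, and oracle answers do not
depend on the input. -/
theorem PartrecFunctional.eventually_mem {A : Set Baire} {Φ : Baire → ℕ →. ℕ}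
    (h : PartrecFunctional A Φ) {p : Baire} {n m : ℕ} (hm : m ∈ Φ p n) :
    ∀ᶠ p' in 𝓝 p, m ∈ Φ p' n := by
  induction h generalizing n m with
  | zero | succ | left | right | oracle a ha => exact .of_forall fun _ => hm
  | input =>
    obtain rfl := Part.mem_some_iff.1 hm
    have := (continuous_apply n).continuousAt.eventually
      (show ∀ᶠ k in 𝓝 (p n), k = p n by simp)
    filter_upwards [this] with p' hp'
    exact Part.mem_some_iff.2 hp'.symm
  | pair _ _ h₁ h₂ =>
    simp only [Seq.seq, Part.map_eq_map, Part.mem_bind_iff, Part.mem_map_iff] at hm ⊢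
    obtain ⟨_, ⟨x, hx, rfl⟩, y, hy, rfl⟩ := hm
    filter_upwards [h₁ hx, h₂ hy] with p' hx' hy'
    exact ⟨_, ⟨x, hx', rfl⟩, y, hy', rfl⟩
  | comp _ _ h₁ h₂ =>
    obtain ⟨k, hk, hm⟩ := Part.mem_bind_iff.1 hm
    filter_upwards [h₁ hm, h₂ hk] with p' h₁' h₂'
    exact Part.mem_bind_iff.2 ⟨k, h₂', h₁'⟩
  | prec _ _ h₁ h₂ =>
    beta_reduce at hm ⊢
    generalize n.unpair.2 = l at hm ⊢
    induction l generalizing m with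
    | zero => exact h₁ hm
    | succ l ih =>
      obtain ⟨i, hi, hm⟩ := Part.mem_bind_iff.1 hm
      filter_upwards [ih hi, h₂ hm] with p' h₁' h₂'
      exact Part.mem_bind_iff.2 ⟨i, h₁', h₂'⟩
  | rfind _ h =>
    obtain ⟨h₀, hlt⟩ := Nat.mem_rfind.1 hm
    simp only [Part.map_eq_map, Part.mem_map_iff] at h₀ hlt
    obtain ⟨x, hx, hx0⟩ := h₀
    replace hlt := fun j hj => @hlt j hj
    choose! y hy hy0 using hlt
    have := (eventually_all_finite (Set.finite_Iio m)).2 fun j (hj : j < m) => h (hy j hj)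
    filter_upwards [h hx, this] with p' hx' hy'
    refine Nat.mem_rfind.2 ⟨(Part.mem_map_iff _).2 ⟨x, hx', hx0⟩, fun {j} hj =>
      (Part.mem_map_iff _).2 ⟨y j, hy' j hj, hy0 j hj⟩⟩

/-- Computable functions are continuous on their domains. -/
theorem ComputableRel.tendsto {A : Set Baire} {F : Baire →. Baire} (hF : ComputableRel A F)
    {ι : Type*} {l : Filter ι} {u v : ι → Baire} {p q : Baire} (hu : Tendsto u l (𝓝 p))
    (hq : q ∈ F p) (hv : ∀ᶠ i in l, v i ∈ F (u i)) : Tendsto v l (𝓝 q) := by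
  obtain ⟨Φ, hΦ, h⟩ := hF
  refine tendsto_pi_nhds.2 fun n => tendsto_nhds_of_eventually_eq ?_
  filter_upwards [hv, hu.eventually (hΦ.eventually_mem (h p q hq n))] with i hi hqi
  exact Part.mem_unique (h _ _ hi n) hqi

theorem continuous_pairSeq : Continuous fun x : Baire × Baire => pairSeq x.1 x.2 := by
  refine continuous_pi fun n => ?_
  unfold pairSeq
  split_ifs <;> fun_prop

theorem continuous_projSeq (i : ℕ) : Continuous (projSeq i) :=
  continuous_pi fun k => continuous_apply (Nat.pair i k)

theorem continuous_tupleSeq : Continuous tupleSeq :=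
  continuous_pi fun n => (continuous_apply n.unpair.2).comp (continuous_apply n.unpair.1)

theorem eventually_apply_eq {ι : Type*} {l : Filter ι} {u : ι → Baire} {p : Baire}
    (hu : Tendsto u l (𝓝 p)) (n : ℕ) : ∀ᶠ i in l, u i n = p n := by
  simpa using tendsto_pi_nhds.1 hu n

/-! ### `LPO` is not reducible to the parallelization of `LLPO` -/

/-- Along every ultrafilter, solutions can be chosen that converge to a solution at the limit. -/
def HasUltraLimits {U V : RepSpace} (g : MultiFun U V) : Prop :=
  ∀ (l : Ultrafilter ℕ) (u : ℕ → Baire) (k : Baire), Tendsto u l (𝓝 k) →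
    (∀ n, ∃ q, Solves g (u n) q) → ∃ (v : ℕ → Baire) (q : Baire),
      (∀ n, Solves g (u n) (v n)) ∧ Solves g k q ∧ Tendsto v l (𝓝 q)

/-- Some convergent sequence in the domain has no solutions converging, along any non-principal
ultrafilter, to a solution at the limit. -/
def SeqDiscontinuous {X Y : RepSpace} (f : MultiFun X Y) : Prop :=
  ∃ (u : ℕ → Baire) (p : Baire), Tendsto u atTop (𝓝 p) ∧ (∀ n, ∃ r, Solves f (u n) r) ∧
    (∃ r, Solves f p r) ∧ ∀ (l : Ultrafilter ℕ) (v : ℕ → Baire) (r : Baire), (l : Filter ℕ) ≤ atTop →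
      (∀ n, Solves f (u n) (v n)) → Solves f p r → ¬ Tendsto v l (𝓝 r)

theorem SeqDiscontinuous.not_reducible {A : Set Baire} {X Y U V : RepSpace} {f : MultiFun X Y}
    {g : MultiFun U V} (hf : SeqDiscontinuous f) (hg : HasUltraLimits g) :
    ¬ WeihrauchReducibleRel A f g := by
  intro h
  obtain ⟨H, K, hH, hK, h⟩ := weihrauchReducibleRel_iff.1 h
  obtain ⟨u, p, hup, hu, hp, hne⟩ := hf
  have hl : ((hyperfilter ℕ : Ultrafilter ℕ) : Filter ℕ) ≤ atTop := Nat.hyperfilter_le_atTop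
  have hup' := hup.mono_left hl
  obtain ⟨k, hk, -, hks⟩ := h p hp
  choose w hw hwd hws using fun n => h (u n) (hu n)
  have hwk := hK.tendsto hup' hk (.of_forall hw)
  obtain ⟨v, q, hv, hq, hvq⟩ := hg _ w k hwk hwd
  obtain ⟨r, hr, hpr⟩ := hks q hq
  choose s hs hus using fun n => hws n (v n) (hv n)
  exact hne _ s r hl hus hpr <| hH.tendsto
    ((continuous_pairSeq.tendsto (p, q)).comp (hup'.prodMk_nhds hvq)) hr (.of_forall hs)

/-- A single ultrafilter serves all components at once, so no diagonal subsequence is needed. -/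
theorem HasUltraLimits.parallelization {U V : RepSpace} {g : MultiFun U V}
    (hg : HasUltraLimits g) : HasUltraLimits (parallelization g) := by
  intro l u k huk hu
  have := fun i => hg l (fun n => projSeq i (u n)) (projSeq i k)
    (((continuous_projSeq i).tendsto k).comp huk)
    fun n => (hu n).imp' _ fun q hq => solves_parallelization.1 hq i
  choose v q hv hq hvq using this
  refine ⟨fun n => tupleSeq fun i => v i n, tupleSeq q,
    fun n => solves_parallelization.2 fun i => ?_, solves_parallelization.2 fun i => ?_,
    (continuous_tupleSeq.tendsto q).comp (tendsto_pi_nhds.2 hvq)⟩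
  · rw [projSeq_tupleSeq]; exact hv i n
  · rw [projSeq_tupleSeq]; exact hq i

/-- Constant families of instances carry the discontinuity over; component 0 recovers it. -/
theorem SeqDiscontinuous.parallelization {X Y : RepSpace} {f : MultiFun X Y}
    (hf : SeqDiscontinuous f) : SeqDiscontinuous (parallelization f) := by
  obtain ⟨u, p, hup, hu, hp, hne⟩ := hf
  refine ⟨fun n => tupleSeq fun _ => u n, tupleSeq fun _ => p,
    (continuous_tupleSeq.tendsto _).comp (tendsto_pi_nhds.2 fun _ => hup),
    fun n => exists_solves_parallelization fun i => by rw [projSeq_tupleSeq]; exact hu n,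
    exists_solves_parallelization fun i => by rw [projSeq_tupleSeq]; exact hp, ?_⟩
  intro l v r hl hv hr hvr
  refine hne l (fun n => projSeq 0 (v n)) (projSeq 0 r) hl (fun n => ?_) ?_
    (((continuous_projSeq 0).tendsto r).comp hvr)
  · simpa only [projSeq_tupleSeq] using solves_parallelization.1 (hv n) 0
  · simpa only [projSeq_tupleSeq] using solves_parallelization.1 hr 0

theorem tendsto_update_atTop (b : Baire) {e : ℕ → ℕ} (he : Tendsto e atTop atTop) (c : ℕ) :
    Tendsto (fun n => Function.update b (e n) c) atTop (𝓝 b) := by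
  refine tendsto_pi_nhds.2 fun k => tendsto_nhds_of_eventually_eq ?_
  filter_upwards [he.eventually_gt_atTop k] with n hn
  exact Function.update_of_ne hn.ne _ _

theorem seqDiscontinuous_LPO : SeqDiscontinuous LPO := by
  refine ⟨fun n => Function.update (fun _ => 1) n 0, fun _ => 1,
    tendsto_update_atTop _ tendsto_id 0, fun _ => exists_solves_LPO _, exists_solves_LPO _, ?_⟩
  intro l v r _ hv hr hvr
  obtain ⟨n, hn⟩ := (eventually_apply_eq hvr 0).exists
  have h₁ : r 0 = 1 := by simpa using solves_LPO.1 hr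
  rcases solves_LPO.1 (hv n) with ⟨h, -⟩ | ⟨-, h⟩
  · omega
  · exact h n (Function.update_self ..)

theorem hasUltraLimits_LLPO : HasUltraLimits LLPO := by
  intro l u k huk hu
  choose v hv using hu
  have hdom : ∀ i j, k i ≠ 0 → k j ≠ 0 → i = j := by
    intro i j hi hj
    obtain ⟨n, hni, hnj⟩ := ((eventually_apply_eq huk i).and (eventually_apply_eq huk j)).exists
    exact (solves_LLPO.1 (hv n)).1 i j (hni ▸ hi) (hnj ▸ hj)
  have hlim : ∀ c : ℕ, (∀ᶠ n in (l : Filter ℕ), v n 0 = c) → Solves LLPO k (fun _ => c) →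
      ∃ (v : ℕ → Baire) (q : Baire),
        (∀ n, Solves LLPO (u n) (v n)) ∧ Solves LLPO k q ∧ Tendsto v l (𝓝 q) := by
    intro c hc hk
    -- Only place 0 of a name matters; the tails of `v n` need not converge, so constant names
    -- replace them.
    refine ⟨fun n _ => v n 0, fun _ => c, fun n => solves_LLPO.2 (solves_LLPO.1 (hv n)), hk,
      tendsto_pi_nhds.2 fun _ => tendsto_nhds_of_eventually_eq hc⟩
  have hor : ∀ᶠ n in (l : Filter ℕ), v n 0 = 0 ∨ v n 0 = 1 :=
    .of_forall fun n => (solves_LLPO.1 (hv n)).2.imp And.left And.left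
  rcases Ultrafilter.eventually_or.1 hor with h | h
  · refine hlim 0 h (solves_LLPO.2 ⟨hdom, .inl ⟨rfl, fun m => ?_⟩⟩)
    obtain ⟨n, h0, hn⟩ := (h.and (eventually_apply_eq huk (2 * m))).exists
    rcases (solves_LLPO.1 (hv n)).2 with ⟨-, h'⟩ | ⟨h', -⟩
    · exact hn ▸ h' m
    · omega
  · refine hlim 1 h (solves_LLPO.2 ⟨hdom, .inr ⟨rfl, fun m => ?_⟩⟩)
    obtain ⟨n, h1, hn⟩ := (h.and (eventually_apply_eq huk (2 * m + 1))).exists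
    rcases (solves_LLPO.1 (hv n)).2 with ⟨h', -⟩ | ⟨-, h'⟩
    · omega
    · exact hn ▸ h' m

/-! ### The parallelization of `LLPO` is not reducible to `LPO` -/

theorem projSeq_update_self (i n c : ℕ) (b : Baire) :
    projSeq i (Function.update b (Nat.pair i n) c) = Function.update (projSeq i b) n c := by
  funext k
  simp [projSeq, Function.update_apply, Nat.pair_eq_pair]

theorem projSeq_update_of_ne {i j : ℕ} (h : j ≠ i) (n c : ℕ) (b : Baire) :
    projSeq j (Function.update b (Nat.pair i n) c) = projSeq j b := by
  funext k
  simp [projSeq, Nat.pair_eq_pair, h]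

theorem exists_solves_parallelization_LLPO_update {b : Baire} {i : ℕ}
    (hb : ∃ r, Solves (parallelization LLPO) b r) (hi : projSeq i b = 0) (n : ℕ) :
    ∃ r, Solves (parallelization LLPO) (Function.update b (Nat.pair i n) 1) r := by
  obtain ⟨r, hr⟩ := hb
  refine exists_solves_parallelization fun j => ?_
  obtain rfl | hj := eq_or_ne j i
  · rw [projSeq_update_self, hi]
    refine exists_solves_LLPO fun k l hk hl => ?_
    simp only [Function.update_apply, Pi.zero_apply, ne_eq, ite_eq_right_iff, one_ne_zero,
      imp_false, not_not] at hk hl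
    rw [hk, hl]
  · rw [projSeq_update_of_ne hj]
    exact ⟨_, solves_parallelization.1 hr j⟩

/-- No continuous function solves the parallelization of `LLPO` near a point with a vanishing
component. -/
theorem not_tendsto_solutions {b r : Baire} {i : ℕ} {v : ℕ → Baire}
    (hi : projSeq i b = 0) (hr : Solves (parallelization LLPO) b r)
    (hv : ∀ᶠ n in atTop,
      Solves (parallelization LLPO) (Function.update b (Nat.pair i n) 1) (v n)) :
    ¬ Tendsto v atTop (𝓝 r) := by
  intro h
  obtain ⟨N, hN⟩ := eventually_atTop.1 (hv.and (eventually_apply_eq h (Nat.pair i 0)))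
  have key : ∀ n ≥ N, _ := fun n hn => (solves_LLPO.1 (solves_parallelization.1 (hN n hn).1 i)).2
  simp only [projSeq_update_self, hi] at key
  have hval : ∀ n ≥ N, projSeq i (v n) 0 = projSeq i r 0 := fun n hn => (hN n hn).2
  -- From `N` on the answer agrees with the limit; a 1 at the even place `2 * N` refutes answer 0,
  -- and one at `2 * N + 1` refutes answer 1.
  rcases (solves_LLPO.1 (solves_parallelization.1 hr i)).2 with ⟨h0, -⟩ | ⟨h1, -⟩
  · rcases key (2 * N) (by omega) with ⟨-, h'⟩ | ⟨h', -⟩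
    · simpa using h' N
    · have := hval (2 * N) (by omega); omega
  · rcases key (2 * N + 1) (by omega) with ⟨h', -⟩ | ⟨-, h'⟩
    · have := hval (2 * N + 1) (by omega); omega
    · simpa using h' N

theorem not_parallelization_LLPO_le_LPO (A : Set Baire) :
    ¬ WeihrauchReducibleRel A (parallelization LLPO) LPO := by
  intro h
  obtain ⟨H, K, hH, hK, h⟩ := weihrauchReducibleRel_iff.1 h
  choose! k hk _ hks using h
  -- With `q` fixed, `H` would turn the perturbed instances into solutions converging to a solution
  -- at `b`.
  have hnotsame : ∀ (b q : Baire) (i : ℕ), (∃ r, Solves (parallelization LLPO) b r) →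
      projSeq i b = 0 → Solves LPO (k b) q →
      ¬ ∀ᶠ n in atTop, Solves LPO (k (Function.update b (Nat.pair i n) 1)) q := by
    intro b q i hb hi hq hev
    choose! s hs hsol using hks
    have hdom := exists_solves_parallelization_LLPO_update hb hi
    have hpair : Tendsto (Nat.pair i) atTop atTop :=
      tendsto_atTop_mono (Nat.right_le_pair i) tendsto_id
    refine not_tendsto_solutions hi (hsol b hb q hq)
      (v := fun n => s (Function.update b (Nat.pair i n) 1) q)
      (hev.mono fun n hn => hsol _ (hdom n) q hn) ?_
    refine hH.tendsto ((continuous_pairSeq.tendsto (b, q)).comp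
      ((tendsto_update_atTop b hpair 1).prodMk_nhds tendsto_const_nhds)) (hs b hb q hq)
      (hev.mono fun n hn => hs _ (hdom n) q hn)
  have hnonzero : ∀ (b : Baire) (i : ℕ), (∃ r, Solves (parallelization LLPO) b r) →
      projSeq i b = 0 → ∀ n, k b n ≠ 0 := by
    intro b i hb hi m hm
    have hdom := exists_solves_parallelization_LLPO_update hb hi
    have hpair : Tendsto (Nat.pair i) atTop atTop :=
      tendsto_atTop_mono (Nat.right_le_pair i) tendsto_id
    have hlim := hK.tendsto (tendsto_update_atTop b hpair 1) (hk b hb)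
      (.of_forall fun n => hk _ (hdom n))
    refine hnotsame b (fun _ => 0) i hb hi (solves_LPO.2 (.inl ⟨rfl, m, hm⟩)) ?_
    -- By continuity of `K`, the zero at place `m` persists, and with it the answer 0.
    filter_upwards [eventually_apply_eq hlim m] with n hn
    exact solves_LPO.2 (.inl ⟨rfl, m, hn.trans hm⟩)
  have hdom₀ : ∃ r, Solves (parallelization LLPO) (0 : Baire) r :=
    exists_solves_parallelization fun i => exists_solves_LLPO fun j _ hj => absurd rfl hj
  -- Component 0 is perturbed while component 1 still vanishes, so `hnonzero` keeps the answer at 1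
  -- throughout.
  refine hnotsame 0 (fun _ => 1) 0 hdom₀ rfl
    (solves_LPO.2 (.inr ⟨rfl, hnonzero 0 0 hdom₀ rfl⟩)) (.of_forall fun n => ?_)
  exact solves_LPO.2 (.inr ⟨rfl, hnonzero _ 1
    (exists_solves_parallelization_LLPO_update hdom₀ rfl n)
    (projSeq_update_of_ne one_ne_zero n 1 0)⟩)

end WeihrauchDegrees

open WeihrauchDegrees in
theorem mainTheorem4 :
    (WeihrauchDegrees.WeihrauchLT WeihrauchDegrees.LLPO WeihrauchDegrees.LPO ∧
      WeihrauchDegrees.WeihrauchIncomparable WeihrauchDegrees.LPO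
        (WeihrauchDegrees.parallelization WeihrauchDegrees.LLPO) ∧
      WeihrauchDegrees.WeihrauchLT (WeihrauchDegrees.parallelization WeihrauchDegrees.LLPO)
        (WeihrauchDegrees.parallelization WeihrauchDegrees.LPO)) ∧
    ∀ a : ℕ → ℕ,
      ¬ WeihrauchDegrees.WeihrauchReducibleRel {a} WeihrauchDegrees.LPO WeihrauchDegrees.LLPO ∧
      ¬ WeihrauchDegrees.WeihrauchReducibleRel {a} WeihrauchDegrees.LPO
        (WeihrauchDegrees.parallelization WeihrauchDegrees.LLPO) ∧
      ¬ WeihrauchDegrees.WeihrauchReducibleRel {a}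
        (WeihrauchDegrees.parallelization WeihrauchDegrees.LLPO) WeihrauchDegrees.LPO ∧
      ¬ WeihrauchDegrees.WeihrauchReducibleRel {a}
        (WeihrauchDegrees.parallelization WeihrauchDegrees.LPO)
        (WeihrauchDegrees.parallelization WeihrauchDegrees.LLPO) := by
  have hpar := hasUltraLimits_LLPO.parallelization
  have h₁ : ∀ A, ¬ WeihrauchReducibleRel A LPO LLPO := fun _ =>
    seqDiscontinuous_LPO.not_reducible hasUltraLimits_LLPO
  have h₂ : ∀ A, ¬ WeihrauchReducibleRel A LPO (parallelization LLPO) := fun _ =>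
    seqDiscontinuous_LPO.not_reducible hpar
  have h₃ := not_parallelization_LLPO_le_LPO
  have h₄ : ∀ A, ¬ WeihrauchReducibleRel A (parallelization LPO) (parallelization LLPO) :=
    fun _ => seqDiscontinuous_LPO.parallelization.not_reducible hpar
  exact ⟨⟨⟨LLPO_le_LPO, h₁ ∅⟩, ⟨h₂ ∅, h₃ ∅⟩, parallelization_LLPO_le_parallelization_LPO, h₄ ∅⟩,
    fun a => ⟨h₁ {a}, h₂ {a}, h₃ {a}, h₄ {a}⟩⟩
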